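/- Conventions. Partitions are identified with Young diagrams; $\lambda'$ is the transpose of $\lambda$, $|\lambda|$ its weight, $m_j(\lambda)$ the number of parts of $\lambda$ equal to $j$, and $\mu\prec\lambda$ means that $\mu\subseteq\lambda$ and $\lambda-\mu$ is a horizontal strip (no two boxes in the same column). For $t\in(0,1)$ put $$P_{\lambda/\mu}(x)=\mathbf 1_{\mu\prec\lambda}\,x^{|\lambda|-|\mu|}\prod_{j\ge 1:\ \lambda'_{j+1}>\mu'_{j+1},\ \lambda'_j=\mu'_j}\bigl(1-t^{m_j(\mu)}\bigr),\qquad Q_{\lambda/\mu}(x)=\mathbf 1_{\mu\prec\lambda}\,x^{|\lambda|-|\mu|}\prod_{i\ge 1:\ \lambda'_{i+1}=\mu'_{i+1},\ \lambda'_i>\mu'_i}\bigl(1-t^{m_i(\lambda)}\bigr),$$ the one-variable skew Hall--Littlewood functions, and let $$Q_\lambda(\zeta^N)=\sum_{\lambda=\nu^0,\nu^1,\dots,\nu^N=\varnothing}\ \prod_{n=1}^N Q_{\nu^{n-1}/\nu^n}(\zeta)$$ be the Hall--Littlewood function $Q_\lambda$ with $N$ variables specialized to $\zeta$. For integers $M,N\ge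 1$ and $\zeta,t\in(0,1)$ the homogeneous ascending Hall--Littlewood process (HAHP) $\mathbb P^{M,N}_\zeta$ is the probability distribution on sequences of partitions $\varnothing=\lambda(0)\prec\lambda(1)\prec\dots\prec\lambda(M)$ with $$\mathbb P^{M,N}_\zeta(\lambda(1),\dots,\lambda(M))=\Bigl(\frac{1-\zeta}{1-t\zeta}\Bigr)^{NM}\ \prod_{i=1}^M P_{\lambda(i)/\lambda(i-1)}(1)\ \cdot\ Q_{\lambda(M)}(\zeta^N).$$ An up-right path on $\llbracket T_0,T_1\rrbracket=\{T_0,\dots,T_1\}$ is a function $\ell:\llbracket T_0,T_1\rrbracket\to\mathbb Z$ all of whose increments $\ell(s+1)-\ell(s)$ lie in $\{0,1\}$; a discrete line ensemble on $\llbracket T_0,T_1\rrbracket$ is a random $N$-tuple $(L_1,\dots,L_N)$ of up-right paths; put $L_0=\infty$. For up-right paths $f,\ell,g$ (where $f=\infty$ is allowed) and $S\subseteq\llbracket T_0+1,T_1\rrbracket$ let $$W_t(\ell,f,g;S)=\prod_{s\in S}\bigl(1-\mathbf 1_{\{\Delta^+(s-1)-\Delta^+(s)=1\}}t^{\Delta^+(s-1)}\bigr)\bigl(1-\mathbf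 1_{\{\Delta^-(s-1)-\Delta^-(s)=1\}}t^{\Delta^-(s-1)}\bigr),\quad \Delta^+=f-\ell,\ \Delta^-=\ell-g,$$ if $f(s)\ge \ell(s)\ge g(s)$ for all $s\in S$, and $W_t(\ell,f,g;S)=0$ otherwise; if $f=\infty$, the factors with $\Delta^+$ equal $1$. The law $\mathbb P$ of a discrete line ensemble has the Hall--Littlewood Gibbs property with parameter $t$ on $S$ if for every $1\le i\le N-1$, all integers $a,b$, every up-right path $g$ and every $f$ (an up-right path if $i\ge 2$, and $f=\infty$ if $i=1$) for which the event $E=\{L_i(T_0)=a,\ L_i(T_1)=b,\ L_{i-1}=f,\ L_{i+1}=g\}$ has positive probability, and every up-right path $\ell$ with $\ell(T_0)=a$, $\ell(T_1)=b$, $$\mathbb P(L_i=\ell\mid E)=\frac{W_t(\ell,f,g;S)}{Z},\qquad Z=\sum_{\tilde\ell}W_t(\tilde\ell,f,g;S)>0,$$ where the sum is over the up-right paths $\tilde\ell$ from $(T_0,a)$ to $(T_1,b)$. (For $N=1$ the property is void.) Proposition. Let $M,N\ge 1$ be integers and $\zeta,t\in(0,1)$. If $\varnothing=\lambda(0)\prec\lambda(1)\prec\dots\prec\lambda(M)$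 is distributed according to $\mathbb P^{M,N}_\zeta$, then $(\lambda'_1(\cdot),\dots,\lambda'_N(\cdot))$ is a discrete line ensemble on $\llbracket 0,M\rrbracket$, and its law has the Hall--Littlewood Gibbs property with parameter $t$ on $S=\llbracket 1,M\rrbracket$. -/

import Mathlib

open MeasureTheory ProbabilityTheory

noncomputable section

namespace HallLittlewood

/-! ### Partitions, interlacing and one-variable skew Hall-Littlewood functions

Partitions are identified with Young diagrams. The parts are numbered from `1`. -/

/-- The `i`-th part `μ'_i` (`i ≥ 1`) of the conjugate (transposed) partition. -/
def conjPart (μ : YoungDiagram) (i : ℕ) : ℕ := μ.transpose.rowLen (i - 1)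

/-- The multiplicity `m_i(μ)` (`i ≥ 1`): the number of parts of `μ` that are equal to `i`. -/
def mult (μ : YoungDiagram) (i : ℕ) : ℕ := {r : ℕ | μ.rowLen r = i}.ncard

/-- `μ ≺ κ`: the skew diagram `κ - μ` is a horizontal strip, i.e. `μ ⊆ κ` and no two boxes of
`κ - μ` lie in the same column (a cell is a pair `(row, column)`). -/
def Interlace (μ κ : YoungDiagram) : Prop :=
  μ ≤ κ ∧ ∀ c ∈ κ.cells \ μ.cells, ∀ d ∈ κ.cells \ μ.cells, c.2 = d.2 → c = d

open Classical in
/-- `ψ_{κ/μ}(t)`. All indices `j` with `κ'_{j+1} > μ'_{j+1}` are at most the first part of `κ`. -/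
def psi (t : ℝ) (κ μ : YoungDiagram) : ℝ :=
  if Interlace μ κ then
    ∏ j ∈ (Finset.Icc 1 (κ.rowLen 0)).filter (fun j =>
        conjPart μ (j + 1) < conjPart κ (j + 1) ∧ conjPart κ j = conjPart μ j),
      (1 - t ^ mult μ j)
  else 0

open Classical in
/-- `φ_{κ/μ}(t)`. All indices `i` with `κ'_i > μ'_i` are at most the first part of `κ`. -/
def phi (t : ℝ) (κ μ : YoungDiagram) : ℝ :=
  if Interlace μ κ then
    ∏ i ∈ (Finset.Icc 1 (κ.rowLen 0)).filter (fun i =>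
        conjPart κ (i + 1) = conjPart μ (i + 1) ∧ conjPart μ i < conjPart κ i),
      (1 - t ^ mult κ i)
  else 0

/-- The skew Hall-Littlewood function `P_{κ/μ}(x; t)` in one variable. -/
def skewP (t : ℝ) (κ μ : YoungDiagram) (x : ℝ) : ℝ := psi t κ μ * x ^ (κ.card - μ.card)

/-- The skew Hall-Littlewood function `Q_{κ/μ}(x; t)` in one variable. -/
def skewQ (t : ℝ) (κ μ : YoungDiagram) (x : ℝ) : ℝ := phi t κ μ * x ^ (κ.card - μ.card)

open Classical in
/-- The skew Hall-Littlewood function `Q_{κ/μ}(x₁, …, x_n; t)` in finitely many variables, by the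
branching rule `Q_{κ/μ}(x₁, x₂, …) = ∑_ν Q_{κ/ν}(x₁) Q_{ν/μ}(x₂, …)`; only the finitely many
`ν ⊆ κ` contribute. -/
def skewQList (t : ℝ) : List ℝ → YoungDiagram → YoungDiagram → ℝ
  | [], κ, μ => if κ = μ then 1 else 0
  | x :: xs, κ, μ => ∑ᶠ ν : YoungDiagram, skewQ t κ ν x * skewQList t xs ν μ

/-- `Q_κ(ζ^N; t)`: the Hall-Littlewood function `Q_κ` with `N` variables specialized to `ζ`. -/
def QSpec (t ζ : ℝ) (N : ℕ) (κ : YoungDiagram) : ℝ := skewQList t (List.replicate N ζ) κ ⊥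

/-! ### The homogeneous ascending Hall-Littlewood process -/

/-- Sequences of partitions `∅ = lam 0 ≺ lam 1 ≺ ⋯ ≺ lam M`. -/
structure AscSeq (M : ℕ) where
  lam : Fin (M + 1) → YoungDiagram
  lam_zero : lam 0 = ⊥
  interlace : ∀ i : Fin M, Interlace (lam i.castSucc) (lam i.succ)

instance (M : ℕ) : MeasurableSpace (AscSeq M) := ⊤

/-- The mass that the homogeneous ascending Hall-Littlewood process gives to a sequence. -/
def hahpMass (M N : ℕ) (t ζ : ℝ) (s : AscSeq M) : ℝ :=
  ((1 - ζ) / (1 - t * ζ)) ^ (N * M) *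
    (∏ i : Fin M, skewP t (s.lam i.succ) (s.lam i.castSucc) 1) * QSpec t ζ N (s.lam (Fin.last M))

/-- The homogeneous ascending Hall-Littlewood process, as a discrete measure. -/
def hahp (M N : ℕ) (t ζ : ℝ) : Measure (AscSeq M) :=
  Measure.sum fun s : AscSeq M => ENNReal.ofReal (hahpMass M N t ζ s) • Measure.dirac s

/-! ### Discrete line ensembles -/

/-- Up-right paths on the integer interval `{T₀, …, T₁}`. -/
structure UpRightPath (T₀ T₁ : ℤ) where
  toFun : Set.Icc T₀ T₁ → ℤ
  step : ∀ i j : Set.Icc T₀ T₁, (j : ℤ) = i + 1 → toFun j - toFun i = 0 ∨ toFun j - toFun i = 1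

/-- The value of a path at `s`; the value `0` outside of `{T₀, …, T₁}` is a placeholder. -/
def UpRightPath.val {T₀ T₁ : ℤ} (f : UpRightPath T₀ T₁) (s : ℤ) : ℤ :=
  if h : s ∈ Set.Icc T₀ T₁ then f.toFun ⟨s, h⟩ else 0

/-- The space of `N`-tuples of up-right paths on `{T₀, …, T₁}`, with the discrete σ-algebra. The
curve `L_j`, `1 ≤ j ≤ N`, is the component with index `j - 1` in `Fin N`. A discrete line ensemble
is a random variable with values in this space. -/
def EnsembleSpace (N : ℕ) (T₀ T₁ : ℤ) : Type := Fin N → UpRightPath T₀ T₁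

instance (N : ℕ) (T₀ T₁ : ℤ) : MeasurableSpace (EnsembleSpace N T₀ T₁) := ⊤

/-- The curve directly above the one with index `i`; `none` stands for the curve `L_0 = ∞` above
the first one. -/
def EnsembleSpace.above {N : ℕ} {T₀ T₁ : ℤ} (L : EnsembleSpace N T₀ T₁) (i : Fin N) :
    Option (UpRightPath T₀ T₁) :=
  if (i : ℕ) = 0 then none else some (L ⟨(i : ℕ) - 1, by omega⟩)

/-! ### The Hall-Littlewood Gibbs property -/

/-- `∏_{s ∈ S} (1 - 1{Δ(s-1) - Δ(s) = 1} t^{Δ(s-1)})` with `Δ = f - g`. -/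
def gapFactor (t : ℝ) {T₀ T₁ : ℤ} (f g : UpRightPath T₀ T₁) (S : Finset ℤ) : ℝ :=
  ∏ s ∈ S, (1 - if (f.val (s - 1) - g.val (s - 1)) - (f.val s - g.val s) = 1
    then t ^ (f.val (s - 1) - g.val (s - 1)) else 0)

open Classical in
/-- The weight `W_t(T₀, T₁, ℓ, f, g; S)`; for `f = ∞` (that is, `none`) the constraint `f ≥ ℓ` and
the factor that involves `f` disappear. -/
def weight (t : ℝ) {T₀ T₁ : ℤ} (ℓ : UpRightPath T₀ T₁) (f : Option (UpRightPath T₀ T₁))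
    (g : UpRightPath T₀ T₁) (S : Finset ℤ) : ℝ :=
  match f with
  | none => if ∀ s ∈ S, g.val s ≤ ℓ.val s then gapFactor t ℓ g S else 0
  | some f => if ∀ s ∈ S, ℓ.val s ≤ f.val s ∧ g.val s ≤ ℓ.val s
      then gapFactor t f ℓ S * gapFactor t ℓ g S else 0

/-- The set `Ω(T₀, T₁; a, b)` of up-right paths from `(T₀, a)` to `(T₁, b)`. -/
def pathsBetween (T₀ T₁ a b : ℤ) : Set (UpRightPath T₀ T₁) :=
  {ℓ | ℓ.val T₀ = a ∧ ℓ.val T₁ = b}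

/-- There are only finitely many up-right paths between two given points. -/
theorem pathsBetween_finite (T₀ T₁ a b : ℤ) : (pathsBetween T₀ T₁ a b).Finite := by
  have key : ∀ ℓ ∈ pathsBetween T₀ T₁ a b,
      ℓ.toFun ∈ Set.pi Set.univ (fun _ : Set.Icc T₀ T₁ => Set.Icc a (a + (T₁ - T₀))) := by
    intro ℓ hℓ x _
    obtain ⟨x, hx⟩ := x
    have hT : T₀ ≤ T₁ := hx.1.trans hx.2
    have h0 : ℓ.toFun ⟨T₀, le_refl _, hT⟩ = a := by
      have := hℓ.1
      rwa [UpRightPath.val, dif_pos ⟨le_refl _, hT⟩] at this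
    have main : ∀ n : ℕ, ∀ h : T₀ + n ∈ Set.Icc T₀ T₁,
        a ≤ ℓ.toFun ⟨T₀ + n, h⟩ ∧ ℓ.toFun ⟨T₀ + n, h⟩ ≤ a + n := by
      intro n
      induction n with
      | zero => intro h; simp only [Nat.cast_zero, add_zero, h0]; simp
      | succ n ih =>
        intro h
        have h' : T₀ + (n : ℤ) ∈ Set.Icc T₀ T₁ := by
          have := h.2; push_cast at this; constructor <;> linarith
        have h1 := ih h'
        have h2 := ℓ.step ⟨_, h'⟩ ⟨_, h⟩ (by push_cast; ring)
        have h3 : ((n + 1 : ℕ) : ℤ) = n + 1 := by push_cast; ring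
        generalize ℓ.toFun ⟨_, h⟩ = u at h2 ⊢
        omega
    obtain ⟨n, rfl⟩ : ∃ n : ℕ, x = T₀ + n := ⟨(x - T₀).toNat, by have := hx.1; omega⟩
    have := main n hx
    have := hx.2
    constructor <;> linarith
  have hfin : (Set.pi Set.univ (fun _ : Set.Icc T₀ T₁ => Set.Icc a (a + (T₁ - T₀)))).Finite :=
    Set.Finite.pi fun _ => Set.finite_Icc _ _
  refine Set.Finite.of_finite_image (f := UpRightPath.toFun) (hfin.subset ?_) ?_
  · rintro _ ⟨ℓ, hℓ, rfl⟩
    exact key ℓ hℓ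
  · rintro ⟨f, _⟩ _ ⟨g, _⟩ _ h
    simpa using h

/-- The normalization constant: the sum of the weights over the (finitely many) up-right paths
from `(T₀, a)` to `(T₁, b)`. -/
def partitionFn (t : ℝ) {T₀ T₁ : ℤ} (a b : ℤ) (f : Option (UpRightPath T₀ T₁))
    (g : UpRightPath T₀ T₁) (S : Finset ℤ) : ℝ :=
  ∑ ℓ ∈ (pathsBetween_finite T₀ T₁ a b).toFinset, weight t ℓ f g S

/-- The event that `L_i` goes from `(T₀, a)` to `(T₁, b)`, that `L_{i-1} = f` and `L_{i+1} = g`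
(the index of `L_{i+1}` is called `k`). -/
def boundaryEvent {N : ℕ} {T₀ T₁ : ℤ} (i k : Fin N) (a b : ℤ) (f : Option (UpRightPath T₀ T₁))
    (g : UpRightPath T₀ T₁) : Set (EnsembleSpace N T₀ T₁) :=
  {L | (L i).val T₀ = a ∧ (L i).val T₁ = b ∧ L.above i = f ∧ L k = g}

/-- The Hall-Littlewood Gibbs property with parameter `t` for `S ⊆ {T₀ + 1, …, T₁}`, for a
probability distribution `ν` on discrete line ensembles. The conditional probability is required
whenever the conditioning event has positive probability, and then the normalization constant is
required to be positive. -/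
def GibbsProperty (t : ℝ) {N : ℕ} {T₀ T₁ : ℤ} (S : Finset ℤ)
    (ν : Measure (EnsembleSpace N T₀ T₁)) : Prop :=
  ∀ i k : Fin N, (k : ℕ) = i + 1 →
    ∀ (a b : ℤ) (f : Option (UpRightPath T₀ T₁)) (g : UpRightPath T₀ T₁),
      0 < ν (boundaryEvent i k a b f g) →
        0 < partitionFn t a b f g S ∧
        ∀ ℓ ∈ pathsBetween T₀ T₁ a b,
          (ν[|boundaryEvent i k a b f g]).real {L | L i = ℓ} =
            weight t ℓ f g S / partitionFn t a b f g S

end HallLittlewood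

end

namespace HallLittlewood

/-! ### Young diagrams through their column lengths -/

/-! Read in terms of columns, interlacing means that each column grows by 0 or 1 box
(`interlace_iff`), so the columns of an ascending sequence are ordered up-right paths from 0. The
factor `1 - t ^ m_j(μ)` of `psi` appears exactly when column `j` stays and column `j + 1` grows,
that is, when the gap between them drops by 1, and `m_j(μ)` is that gap before the step. Hence the
product of all `psi` is a product of gap factors over neighbouring columns (`psi_eq_prod_range`,
`eventually_prod_psi_eq`), while the `Q` factor depends only on the final diagram.

Changing one column with its endpoint fixed affects only the gap factors with its two neighbours,
whose product is the Gibbs weight (`hahpMass_eq_colWeight_mul`). Replacing `ℓ` by `ℓ'` in that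
column therefore multiplies masses by the ratio of weights. Summing over all the other columns,
including those beyond the first `N`, gives `μ(ℓ) W(ℓ') = μ(ℓ') W(ℓ)` (`hahp_colEvent_mul_le`, used
both ways); summing over `ℓ'` gives the conditional law. -/

theorem lt_rowLen_iff_lt_colLen (μ : YoungDiagram) (r c : ℕ) :
    c < μ.rowLen r ↔ r < μ.colLen c := by
  rw [← YoungDiagram.mem_iff_lt_rowLen, YoungDiagram.mem_iff_lt_colLen]

theorem eq_of_colLen_eq {μ κ : YoungDiagram} (h : ∀ j, μ.colLen j = κ.colLen j) : μ = κ := by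
  ext ⟨r, c⟩
  rw [YoungDiagram.mem_cells, YoungDiagram.mem_cells, YoungDiagram.mem_iff_lt_colLen,
    YoungDiagram.mem_iff_lt_colLen, h]

theorem colLen_bot (j : ℕ) : (⊥ : YoungDiagram).colLen j = 0 := by
  by_contra h
  exact YoungDiagram.notMem_bot _
    (YoungDiagram.mem_iff_lt_colLen.2 (Nat.pos_of_ne_zero h) : (0, j) ∈ (⊥ : YoungDiagram))

theorem conjPart_succ (μ : YoungDiagram) (j : ℕ) : conjPart μ (j + 1) = μ.colLen j := by
  simp [conjPart]

/-- The rows of length `j + 1` are those that reach the column with index `j` but not the next one.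
-/
theorem mult_succ (μ : YoungDiagram) (j : ℕ) :
    mult μ (j + 1) = μ.colLen j - μ.colLen (j + 1) := by
  have h : {r : ℕ | μ.rowLen r = j + 1} =
      (Finset.Ico (μ.colLen (j + 1)) (μ.colLen j) : Finset ℕ) := by
    ext r
    have h1 := lt_rowLen_iff_lt_colLen μ r j
    have h2 := lt_rowLen_iff_lt_colLen μ r (j + 1)
    simp only [Set.mem_ofPred_eq, Finset.coe_Ico, Set.mem_Ico]
    omega
  rw [mult, h, Set.ncard_coe_finset, Nat.card_Ico]

/-- Within one column the boxes of the skew diagram occupy the rows between the two column lengths,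
so a horizontal strip allows at most one of them. -/
theorem interlace_iff (μ κ : YoungDiagram) :
    Interlace μ κ ↔ ∀ j, μ.colLen j ≤ κ.colLen j ∧ κ.colLen j ≤ μ.colLen j + 1 := by
  constructor
  · rintro ⟨hle, hs⟩ j
    constructor
    · by_contra! h
      have h1 : (κ.colLen j, j) ∈ μ := YoungDiagram.mem_iff_lt_colLen.2 h
      exact lt_irrefl _ (YoungDiagram.mem_iff_lt_colLen.1 (hle h1))
    · by_contra! h
      have hmem : ∀ r, μ.colLen j ≤ r → r < κ.colLen j → (r, j) ∈ κ.cells \ μ.cells := by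
        intro r h1 h2
        rw [Finset.mem_sdiff, YoungDiagram.mem_cells, YoungDiagram.mem_cells,
          YoungDiagram.mem_iff_lt_colLen, YoungDiagram.mem_iff_lt_colLen]
        omega
      have := hs _ (hmem (μ.colLen j) le_rfl (by omega)) _
        (hmem (μ.colLen j + 1) (by omega) h) rfl
      simp at this
  · intro h
    refine ⟨?_, ?_⟩
    · rintro ⟨r, c⟩ hc
      exact YoungDiagram.mem_iff_lt_colLen.2
        ((YoungDiagram.mem_iff_lt_colLen.1 hc).trans_le (h c).1)
    · rintro ⟨r, c⟩ h1 ⟨r', c'⟩ h2 (rfl : c = c')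
      rw [Finset.mem_sdiff, YoungDiagram.mem_cells, YoungDiagram.mem_cells,
          YoungDiagram.mem_iff_lt_colLen, YoungDiagram.mem_iff_lt_colLen] at h1 h2
      have := h c
      rw [Prod.mk.injEq]
      omega

/-- One column of a Young diagram can be given any length between its neighbours. -/
theorem exists_colLen_update (μ : YoungDiagram) (c h : ℕ) (hr : μ.colLen (c + 1) ≤ h)
    (hl : ∀ j, j + 1 = c → h ≤ μ.colLen j) :
    ∃ κ : YoungDiagram, κ.colLen c = h ∧ ∀ j, j ≠ c → κ.colLen j = μ.colLen j := by
  have hmem : ∀ r j, (r, j) ∈ μ.cells.filter (fun x => x.2 ≠ c) ∪ Finset.range h ×ˢ {c} ↔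
      r < if j = c then h else μ.colLen j := by
    intro r j
    have : (r, j) ∈ μ.cells ↔ r < μ.colLen j := by
      rw [YoungDiagram.mem_cells, YoungDiagram.mem_iff_lt_colLen]
    by_cases hj : j = c <;> simp [hj, eq_comm (a := c), ← this]
  let κ : YoungDiagram :=
    { cells := μ.cells.filter (fun x => x.2 ≠ c) ∪ Finset.range h ×ˢ {c}
      isLowerSet := by
        rintro ⟨r, j⟩ ⟨r', j'⟩ ⟨h1, h2⟩ hm
        simp only at h1 h2
        rw [Finset.mem_coe, hmem] at hm ⊢
        refine lt_of_le_of_lt h1 (hm.trans_le ?_)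
        have h3 : ∀ x y, x ≤ y → μ.colLen y ≤ μ.colLen x := fun x y hxy => μ.colLen_anti x y hxy
        split_ifs with ha hb hb
        · exact le_rfl
        · subst ha
          obtain ⟨p, rfl⟩ : ∃ p, j = p + 1 := ⟨j - 1, by omega⟩
          exact (hl p rfl).trans (h3 _ _ (by omega))
        · subst hb
          exact (h3 _ _ (by omega)).trans hr
        · exact h3 _ _ h2 }
  have hκ : ∀ j, κ.colLen j = if j = c then h else μ.colLen j := by
    intro j
    have hiff : ∀ r, r < κ.colLen j ↔ r < if j = c then h else μ.colLen j := fun r => by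
      rw [← YoungDiagram.mem_iff_lt_colLen, ← hmem r j]; rfl
    exact le_antisymm (not_lt.1 fun hlt => lt_irrefl _ ((hiff _).1 hlt))
      (not_lt.1 fun hlt => lt_irrefl _ ((hiff _).2 hlt))
  exact ⟨κ, by simp [hκ], fun j hj => by simp [hκ, hj]⟩

/-! ### The columns of an ascending sequence as up-right paths -/

theorem UpRightPath.ext_val {T₀ T₁ : ℤ} {f g : UpRightPath T₀ T₁}
    (h : ∀ s ∈ Set.Icc T₀ T₁, f.val s = g.val s) : f = g := by
  obtain ⟨f, hf⟩ := f
  obtain ⟨g, hg⟩ := g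
  congr
  ext ⟨s, hs⟩
  simpa [UpRightPath.val, hs.1, hs.2] using h s hs

theorem UpRightPath.val_step {T₀ T₁ : ℤ} (f : UpRightPath T₀ T₁) {s : ℤ} (h₀ : T₀ ≤ s)
    (h₁ : s + 1 ≤ T₁) : f.val (s + 1) = f.val s ∨ f.val (s + 1) = f.val s + 1 := by
  have hs : s ∈ Set.Icc T₀ T₁ := ⟨h₀, by omega⟩
  have hs' : s + 1 ∈ Set.Icc T₀ T₁ := ⟨by omega, h₁⟩
  have := f.step ⟨s, hs⟩ ⟨s + 1, hs'⟩ rfl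
  rw [UpRightPath.val, UpRightPath.val, dif_pos hs, dif_pos hs']
  omega

theorem UpRightPath.ext_nat {M : ℕ} {f g : UpRightPath 0 (M : ℤ)}
    (h : ∀ m : Fin (M + 1), f.val ((m : ℕ) : ℤ) = g.val ((m : ℕ) : ℤ)) : f = g := by
  refine UpRightPath.ext_val fun s hs => ?_
  have h1 := hs.1
  have h2 := hs.2
  have := h ⟨s.toNat, by omega⟩
  rwa [show (((⟨s.toNat, by omega⟩ : Fin (M + 1)) : ℕ) : ℤ) = s from Int.toNat_of_nonneg h1]
    at this

/-- The lengths of the column with index `j` (counted from `0`) of the diagrams of an ascending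
sequence, as an up-right path. -/
def AscSeq.col {M : ℕ} (s : AscSeq M) (j : ℕ) : UpRightPath 0 (M : ℤ) where
  toFun x := ((s.lam ⟨(x : ℤ).toNat, by have := x.2.1; have := x.2.2; omega⟩).colLen j : ℤ)
  step := by
    rintro ⟨x, hx⟩ ⟨y, hy⟩ (rfl : y = x + 1)
    have h1 := hx.1
    have h2 := hy.2
    have h := (interlace_iff _ _).1 (s.interlace ⟨x.toNat, by omega⟩) j
    have e : (⟨(x + 1).toNat, by omega⟩ : Fin (M + 1)) = Fin.succ ⟨x.toNat, by omega⟩ := by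
      ext; simp only [Fin.succ_mk]; omega
    simp only [e]
    simp only [Fin.castSucc_mk] at h
    omega

theorem AscSeq.col_val {M : ℕ} (s : AscSeq M) (j : ℕ) (m : Fin (M + 1)) :
    (s.col j).val ((m : ℕ) : ℤ) = (s.lam m).colLen j := by
  have : ((m : ℕ) : ℤ) ∈ Set.Icc (0 : ℤ) M := ⟨by omega, by omega⟩
  rw [UpRightPath.val, dif_pos this]
  simp [AscSeq.col]

theorem AscSeq.col_val_zero {M : ℕ} (s : AscSeq M) (j : ℕ) : (s.col j).val 0 = 0 := by
  have := s.col_val j 0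
  rwa [s.lam_zero, colLen_bot] at this

theorem AscSeq.col_succ_le {M : ℕ} (s : AscSeq M) (j : ℕ) {x : ℤ} (hx : x ∈ Set.Icc 0 (M : ℤ)) :
    (s.col (j + 1)).val x ≤ (s.col j).val x := by
  have h1 := hx.1
  have h2 := hx.2
  have e : (((⟨x.toNat, by omega⟩ : Fin (M + 1)) : ℕ) : ℤ) = x := Int.toNat_of_nonneg h1
  rw [← e, s.col_val, s.col_val]
  exact_mod_cast (s.lam _).colLen_anti _ _ (Nat.le_succ j)

theorem AscSeq.ext_col {M : ℕ} {s s' : AscSeq M} (h : ∀ j, s.col j = s'.col j) : s = s' := by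
  obtain ⟨l, h1, h2⟩ := s
  obtain ⟨l', h1', h2'⟩ := s'
  congr
  ext m : 1
  refine eq_of_colLen_eq fun j => ?_
  have e := congrArg (fun f => f.val ((m : ℕ) : ℤ)) (h j)
  simp only [AscSeq.col_val] at e
  exact_mod_cast e

/-- One column of an ascending sequence can be replaced by any up-right path from `0` that stays
between the neighbouring columns. -/
theorem AscSeq.exists_col_update {M : ℕ} (s : AscSeq M) (c : ℕ) (ℓ : UpRightPath 0 (M : ℤ))
    (h0 : ℓ.val 0 = 0) (hr : ∀ x ∈ Finset.Icc 1 (M : ℤ), (s.col (c + 1)).val x ≤ ℓ.val x)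
    (hl : ∀ j, j + 1 = c → ∀ x ∈ Finset.Icc 1 (M : ℤ), ℓ.val x ≤ (s.col j).val x) :
    ∃ s' : AscSeq M, s'.col c = ℓ ∧ ∀ j, j ≠ c → s'.col j = s.col j := by
  -- The order is assumed at times `1, …, M` only; at time 0 all columns and `ℓ` vanish.
  have hr' : ∀ m : Fin (M + 1), ((s.lam m).colLen (c + 1) : ℤ) ≤ ℓ.val ((m : ℕ) : ℤ) := by
    intro m
    rw [← s.col_val]
    rcases Nat.eq_zero_or_pos (m : ℕ) with hm | hm
    · simp [hm, h0, s.col_val_zero]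
    · exact hr _ (Finset.mem_Icc.2 ⟨by omega, by omega⟩)
  have hl' : ∀ m : Fin (M + 1), ∀ j, j + 1 = c →
      ℓ.val ((m : ℕ) : ℤ) ≤ ((s.lam m).colLen j : ℤ) := by
    intro m j hj
    rw [← s.col_val]
    rcases Nat.eq_zero_or_pos (m : ℕ) with hm | hm
    · simp [hm, h0, s.col_val_zero]
    · exact hl j hj _ (Finset.mem_Icc.2 ⟨by omega, by omega⟩)
  have hex : ∀ m : Fin (M + 1), ∃ κ : YoungDiagram, κ.colLen c = (ℓ.val ((m : ℕ) : ℤ)).toNat ∧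
      ∀ j, j ≠ c → κ.colLen j = (s.lam m).colLen j := fun m =>
    exists_colLen_update _ _ _ (by have := hr' m; omega)
      (fun j hj => by have := hl' m j hj; omega)
  choose κ hκ hκ' using hex
  have hint : ∀ m : Fin M, Interlace (κ m.castSucc) (κ m.succ) := by
    intro m
    rw [interlace_iff]
    intro j
    by_cases hj : j = c
    · subst hj
      have h1 := ℓ.val_step (s := (m : ℕ)) (by omega) (by omega)
      have h2 := hr' m.castSucc
      have h3 := hr' m.succ
      rw [hκ, hκ]
      simp only [Fin.val_castSucc, Fin.val_succ, Nat.cast_add, Nat.cast_one] at h2 h3 ⊢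
      omega
    · rw [hκ' _ j hj, hκ' _ j hj]
      exact (interlace_iff _ _).1 (s.interlace m) j
  have hzero : κ 0 = ⊥ := by
    refine eq_of_colLen_eq fun j => ?_
    rw [colLen_bot]
    by_cases hj : j = c
    · subst hj
      rw [hκ]
      simp [h0]
    · rw [hκ' _ j hj, s.lam_zero, colLen_bot]
  refine ⟨⟨κ, hzero, hint⟩, UpRightPath.ext_nat fun m => ?_, fun j hj =>
    UpRightPath.ext_nat fun m => ?_⟩
  · have := hr' m
    rw [AscSeq.col_val, hκ]
    omega
  · rw [AscSeq.col_val, AscSeq.col_val, hκ' _ j hj]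

/-! ### The mass of a sequence as a product over pairs of neighbouring columns -/

/-- Each column increases by 0 or 1, so a gap drops by 1 only if its left column stays and its right
column grows. The free upper bound `n` allows one range for all diagrams of a sequence. -/
theorem psi_eq_prod_range (t : ℝ) {μ κ : YoungDiagram} (h : Interlace μ κ) {n : ℕ}
    (hn : κ.rowLen 0 ≤ n) :
    psi t κ μ = ∏ j ∈ Finset.range n,
      (1 - if ((μ.colLen j : ℤ) - μ.colLen (j + 1)) - ((κ.colLen j : ℤ) - κ.colLen (j + 1)) = 1
        then t ^ ((μ.colLen j : ℤ) - μ.colLen (j + 1)) else 0) := by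
  classical
  have hi := (interlace_iff _ _).1 h
  have hanti : ∀ j, μ.colLen (j + 1) ≤ μ.colLen j := fun j => μ.colLen_anti _ _ (Nat.le_succ j)
  have hsub : Finset.range (κ.rowLen 0) ⊆ Finset.range n := Finset.range_subset_range.2 hn
  rw [psi, if_pos h, Finset.prod_filter, ← Finset.prod_subset hsub, Finset.range_eq_Ico,
    Finset.prod_Ico_eq_prod_range, Nat.sub_zero, ← Finset.Ico_add_one_right_eq_Icc,
    Finset.prod_Ico_eq_prod_range, Nat.add_sub_cancel]
  · refine Finset.prod_congr rfl fun j _ => ?_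
    have h1 := hi j
    have h2 := hi (j + 1)
    have h3 := hanti j
    rw [add_comm 1 j, zero_add, conjPart_succ, conjPart_succ, conjPart_succ, conjPart_succ,
      mult_succ]
    by_cases hc : μ.colLen (j + 1) < κ.colLen (j + 1) ∧ κ.colLen j = μ.colLen j
    · rw [if_pos hc, if_pos (by omega), ← Nat.cast_sub h3, zpow_natCast]
    · rw [if_neg hc, if_neg (by omega), sub_zero]
  -- Beyond the first part of `κ` all columns are empty, and the factor is 1.
  · intro j _ hj
    have h0 : κ.colLen j = 0 := by
      have := lt_rowLen_iff_lt_colLen κ 0 j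
      have := Finset.mem_range.not.1 hj
      omega
    have h1 := hi j
    have h2 : κ.colLen (j + 1) ≤ κ.colLen j := κ.colLen_anti _ _ (Nat.le_succ j)
    have h3 := hi (j + 1)
    rw [if_neg (by omega), sub_zero]

theorem prod_Icc_one_eq_prod_fin (M : ℕ) (F : ℤ → ℝ) :
    ∏ x ∈ Finset.Icc 1 (M : ℤ), F x = ∏ m : Fin M, F ((m : ℕ) + 1) := by
  refine (Finset.prod_bij (fun (m : Fin M) _ => ((m : ℕ) : ℤ) + 1) ?_ ?_ ?_ ?_).symm
  · intro m _
    rw [Finset.mem_Icc]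
    omega
  · intro m _ m' _ h
    ext
    omega
  · intro x hx
    rw [Finset.mem_Icc] at hx
    exact ⟨⟨(x - 1).toNat, by omega⟩, Finset.mem_univ _, by simp only; omega⟩
  · intro m _
    rfl

/-- The factor of the mass that comes from the columns `j` and `j + 1`. -/
noncomputable def AscSeq.pairFactor (t : ℝ) {M : ℕ} (s : AscSeq M) (j : ℕ) : ℝ :=
  gapFactor t (s.col j) (s.col (j + 1)) (Finset.Icc 1 (M : ℤ))

/-- Stated for all large `n` so that two sequences can be compared over the same range of columns.
-/
theorem eventually_prod_psi_eq (t : ℝ) {M : ℕ} (s : AscSeq M) :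
    ∀ᶠ n in Filter.atTop, ∏ m : Fin M, psi t (s.lam m.succ) (s.lam m.castSucc) =
      ∏ j ∈ Finset.range n, s.pairFactor t j := by
  have h : ∀ᶠ n in Filter.atTop, ∀ m : Fin M, (s.lam m.succ).rowLen 0 ≤ n :=
    Filter.eventually_all.2 fun m => Filter.eventually_ge_atTop _
  filter_upwards [h] with n hn
  rw [Finset.prod_congr rfl fun m _ => psi_eq_prod_range t (s.interlace m) (hn m),
    Finset.prod_comm]
  refine Finset.prod_congr rfl fun j _ => ?_
  rw [AscSeq.pairFactor, gapFactor, prod_Icc_one_eq_prod_fin]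
  refine Finset.prod_congr rfl fun m _ => ?_
  have e1 := fun j => s.col_val j m.castSucc
  have e2 := fun j => s.col_val j m.succ
  simp only [Fin.val_castSucc, Fin.val_succ, Nat.cast_add, Nat.cast_one] at e1 e2
  rw [add_sub_cancel_right, e1, e1, e2, e2]

/-- The curve above the column `c` of an ascending sequence. -/
def AscSeq.aboveCol {M : ℕ} (s : AscSeq M) : ℕ → Option (UpRightPath 0 (M : ℤ))
  | 0 => none
  | c + 1 => some (s.col c)

/-- The weight of the column `c` of a sequence with respect to its neighbours. -/
noncomputable def AscSeq.colWeight (t : ℝ) {M : ℕ} (s : AscSeq M) (c : ℕ) : ℝ :=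
  weight t (s.col c) (s.aboveCol c) (s.col (c + 1)) (Finset.Icc 1 (M : ℤ))

/-- Columns of a diagram are ordered, so the constraint in the weight holds automatically and only
gap factors remain: two in general, one for the first column. -/
theorem AscSeq.colWeight_eq (t : ℝ) {M : ℕ} (s : AscSeq M) (c : ℕ) :
    s.colWeight t c = (∏ j ∈ Finset.range (c + 1) with j + 1 = c ∨ j = c, s.pairFactor t j) := by
  have hord : ∀ j, ∀ x ∈ Finset.Icc 1 (M : ℤ), (s.col (j + 1)).val x ≤ (s.col j).val x := by
    intro j x hx
    rw [Finset.mem_Icc] at hx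
    exact s.col_succ_le j ⟨by omega, hx.2⟩
  cases c with
  | zero =>
    have e : (Finset.range (0 + 1)).filter (fun j => j + 1 = 0 ∨ j = 0) = {0} := by decide
    rw [e, Finset.prod_singleton]
    simp only [AscSeq.colWeight, AscSeq.aboveCol, weight]
    rw [if_pos (hord 0), AscSeq.pairFactor]
  | succ p =>
    have e : (Finset.range (p + 1 + 1)).filter (fun j => j + 1 = p + 1 ∨ j = p + 1) =
        {p, p + 1} := by
      ext j
      simp only [Finset.mem_filter, Finset.mem_range, Finset.mem_insert, Finset.mem_singleton]
      omega
    rw [e, Finset.prod_pair (by omega)]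
    simp only [AscSeq.colWeight, AscSeq.aboveCol, weight]
    rw [if_pos fun x hx => ⟨hord p x hx, hord (p + 1) x hx⟩, AscSeq.pairFactor,
      AscSeq.pairFactor]

/-- If two sequences differ in one column only, and this column has the same endpoint in both,
their masses are the weights of this column times a common factor. -/
theorem hahpMass_eq_colWeight_mul (N : ℕ) (t ζ : ℝ) {M : ℕ} (s s' : AscSeq M) (c : ℕ)
    (h : ∀ j, j ≠ c → s'.col j = s.col j) (hM : (s'.col c).val M = (s.col c).val M) :
    ∃ R : ℝ, hahpMass M N t ζ s = s.colWeight t c * R ∧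
      hahpMass M N t ζ s' = s'.colWeight t c * R := by
  -- Equal final diagrams make the `Q` factors agree.
  have hlast : s'.lam (Fin.last M) = s.lam (Fin.last M) := by
    refine eq_of_colLen_eq fun j => ?_
    have e1 := s.col_val j (Fin.last M)
    have e2 := s'.col_val j (Fin.last M)
    rw [Fin.val_last] at e1 e2
    by_cases hj : j = c
    · subst hj
      rw [e1, e2] at hM
      exact_mod_cast hM
    · rw [h j hj, e1] at e2
      exact_mod_cast e2.symm
  obtain ⟨n, h1, h2, hn⟩ := ((eventually_prod_psi_eq t s).and ((eventually_prod_psi_eq t s').and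
    (Filter.eventually_ge_atTop (c + 1)))).exists
  have hfil : (Finset.range n).filter (fun j => j + 1 = c ∨ j = c) =
      (Finset.range (c + 1)).filter (fun j => j + 1 = c ∨ j = c) := by
    ext j
    simp only [Finset.mem_filter, Finset.mem_range]
    omega
  have hrest : ∏ j ∈ Finset.range n with ¬(j + 1 = c ∨ j = c), s'.pairFactor t j =
      ∏ j ∈ Finset.range n with ¬(j + 1 = c ∨ j = c), s.pairFactor t j := by
    refine Finset.prod_congr rfl fun j hj => ?_
    rw [Finset.mem_filter, not_or] at hj
    rw [AscSeq.pairFactor, AscSeq.pairFactor, h _ hj.2.1, h _ hj.2.2]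
  refine ⟨((1 - ζ) / (1 - t * ζ)) ^ (N * M) *
    (∏ j ∈ Finset.range n with ¬(j + 1 = c ∨ j = c), s.pairFactor t j) *
      QSpec t ζ N (s.lam (Fin.last M)), ?_, ?_⟩
  · simp only [hahpMass, skewP, one_pow, mul_one]
    rw [h1, ← Finset.prod_filter_mul_prod_filter_not _ (fun j => j + 1 = c ∨ j = c), hfil,
      AscSeq.colWeight_eq]
    ring
  · simp only [hahpMass, skewP, one_pow, mul_one]
    rw [h2, ← Finset.prod_filter_mul_prod_filter_not _ (fun j => j + 1 = c ∨ j = c), hfil,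
      AscSeq.colWeight_eq, hlast, hrest]
    ring

theorem gapFactor_nonneg {t : ℝ} (ht : t ∈ Set.Ioo (0 : ℝ) 1) {T₀ T₁ : ℤ}
    (f g : UpRightPath T₀ T₁) (S : Finset ℤ) (h : ∀ s ∈ S, g.val (s - 1) ≤ f.val (s - 1)) :
    0 ≤ gapFactor t f g S := by
  refine Finset.prod_nonneg fun s hs => ?_
  split_ifs
  · rw [sub_nonneg, ← Int.toNat_of_nonneg (sub_nonneg.2 (h s hs)), zpow_natCast]
    exact pow_le_one₀ ht.1.le ht.2.le
  · norm_num

theorem weight_nonneg {t : ℝ} (ht : t ∈ Set.Ioo (0 : ℝ) 1) {T₁ : ℤ}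
    (ℓ : UpRightPath 0 T₁) (f : Option (UpRightPath 0 T₁)) (g : UpRightPath 0 T₁)
    (hℓ : ℓ.val 0 = 0) (hf : ∀ f' ∈ f, f'.val 0 = 0) (hg : g.val 0 = 0) :
    0 ≤ weight t ℓ f g (Finset.Icc 1 T₁) := by
  have key : ∀ u v : UpRightPath 0 T₁, u.val 0 = 0 → v.val 0 = 0 →
      (∀ s ∈ Finset.Icc 1 T₁, v.val s ≤ u.val s) →
      0 ≤ gapFactor t u v (Finset.Icc 1 T₁) := by
    intro u v hu hv h
    refine gapFactor_nonneg ht _ _ _ fun s hs => ?_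
    rw [Finset.mem_Icc] at hs
    -- The factor at `s = 1` involves the gap at time 0, which the constraint on `1, …, T₁` does not
    -- control; it is 0 because both paths start at 0.
    rcases eq_or_ne s 1 with rfl | h1
    · rw [sub_self, hu, hv]
    · exact h _ (Finset.mem_Icc.2 ⟨by omega, by omega⟩)
  cases f with
  | none =>
    simp only [weight]
    split_ifs with h
    · exact key _ _ hℓ hg h
    · exact le_rfl
  | some f =>
    have hf' := hf f rfl
    simp only [weight]
    split_ifs with h
    · exact mul_nonneg (key _ _ hf' hℓ fun s hs => (h s hs).1)
        (key _ _ hℓ hg fun s hs => (h s hs).2)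
    · exact le_rfl

/-! ### The Gibbs property -/

/-- The first `N` columns of an ascending sequence. -/
def AscSeq.ensemble {M : ℕ} (N : ℕ) (s : AscSeq M) : EnsembleSpace N 0 (M : ℤ) :=
  fun j => s.col j

theorem AscSeq.ensemble_above {M N : ℕ} (s : AscSeq M) (i : Fin N) :
    (s.ensemble N).above i = s.aboveCol i := by
  obtain ⟨i, hi⟩ := i
  cases i with
  | zero => rfl
  | succ p => simp [EnsembleSpace.above, AscSeq.aboveCol, AscSeq.ensemble]

theorem measurable_of_ascSeq {M : ℕ} {α : Type*} [MeasurableSpace α] (F : AscSeq M → α) :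
    Measurable F := fun _ _ => trivial

theorem hahp_apply (M N : ℕ) (t ζ : ℝ) (A : Set (AscSeq M)) :
    hahp M N t ζ A = ∑' s : A, ENNReal.ofReal (hahpMass M N t ζ s) := by
  classical
  have hA : MeasurableSet A := trivial
  rw [hahp, Measure.sum_apply _ hA, tsum_subtype A fun s => ENNReal.ofReal (hahpMass M N t ζ s)]
  refine tsum_congr fun s => ?_
  rw [Measure.smul_apply, Measure.dirac_apply' _ hA, smul_eq_mul, Set.indicator_apply,
    Set.indicator_apply]
  split_ifs <;> simp

/-- The sequences whose column `c` is `ℓ` and whose columns next to it are `f` and `g`. -/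
def colEvent {M : ℕ} (c : ℕ) (ℓ : UpRightPath 0 (M : ℤ)) (f : Option (UpRightPath 0 (M : ℤ)))
    (g : UpRightPath 0 (M : ℤ)) : Set (AscSeq M) :=
  {s | s.col c = ℓ ∧ s.aboveCol c = f ∧ s.col (c + 1) = g}

theorem AscSeq.aboveCol_congr {M : ℕ} {s s' : AscSeq M} {c : ℕ}
    (h : ∀ j, j ≠ c → s'.col j = s.col j) : s'.aboveCol c = s.aboveCol c := by
  cases c with
  | zero => rfl
  | succ p => simp only [AscSeq.aboveCol, h p (by omega)]

/-- A nonzero weight forces `ℓ` to lie between the neighbouring columns, so it can be substituted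
for column `c`. -/
theorem AscSeq.exists_mem_colEvent {M : ℕ} (s : AscSeq M) (c : ℕ) {ℓ : UpRightPath 0 (M : ℤ)}
    (h0 : ℓ.val 0 = 0) {t : ℝ}
    (hW : weight t ℓ (s.aboveCol c) (s.col (c + 1)) (Finset.Icc 1 (M : ℤ)) ≠ 0) :
    ∃ s' ∈ colEvent c ℓ (s.aboveCol c) (s.col (c + 1)), ∀ j, j ≠ c → s'.col j = s.col j := by
  have hord : (∀ x ∈ Finset.Icc 1 (M : ℤ), (s.col (c + 1)).val x ≤ ℓ.val x) ∧
      ∀ j, j + 1 = c → ∀ x ∈ Finset.Icc 1 (M : ℤ), ℓ.val x ≤ (s.col j).val x := by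
    cases c with
    | zero =>
      simp only [AscSeq.aboveCol, weight] at hW
      exact ⟨by_contra fun h => hW (if_neg h), fun j hj => by omega⟩
    | succ p =>
      simp only [AscSeq.aboveCol, weight] at hW
      have := by_contra fun h => hW (if_neg h)
      refine ⟨fun x hx => (this x hx).2, fun j hj x hx => ?_⟩
      obtain rfl : j = p := by omega
      exact (this x hx).1
  obtain ⟨s', h1, h2⟩ := s.exists_col_update c ℓ h0 hord.1 hord.2
  exact ⟨s', ⟨h1, AscSeq.aboveCol_congr h2, h2 _ (by omega)⟩, h2⟩

/-- Substituting `ℓ'` for `ℓ` is an injection between the two events that rescales masses by the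
weights. An inequality suffices, since the roles of `ℓ` and `ℓ'` can be exchanged. -/
theorem hahp_colEvent_mul_le (N : ℕ) {t : ℝ} (ht : t ∈ Set.Ioo (0 : ℝ) 1) (ζ : ℝ) {M : ℕ} (c : ℕ)
    {ℓ ℓ' : UpRightPath 0 (M : ℤ)} (f : Option (UpRightPath 0 (M : ℤ)))
    (g : UpRightPath 0 (M : ℤ)) (h0 : ℓ.val 0 = 0) (h0' : ℓ'.val 0 = 0)
    (hf : ∀ f' ∈ f, f'.val 0 = 0) (hg : g.val 0 = 0) (hM : ℓ'.val M = ℓ.val M) :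
    hahp M N t ζ (colEvent c ℓ f g) *
        ENNReal.ofReal (weight t ℓ' f g (Finset.Icc 1 (M : ℤ))) ≤
      hahp M N t ζ (colEvent c ℓ' f g) *
        ENNReal.ofReal (weight t ℓ f g (Finset.Icc 1 (M : ℤ))) := by
  by_cases hW : weight t ℓ' f g (Finset.Icc 1 (M : ℤ)) = 0
  · simp [hW]
  have hex : ∀ s : colEvent c ℓ f g, ∃ s' : colEvent c ℓ' f g,
      ∀ j, j ≠ c → s'.1.col j = s.1.col j := by
    rintro ⟨s, rfl, rfl, rfl⟩
    obtain ⟨s', h1, h2⟩ := s.exists_mem_colEvent c h0' hW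
    exact ⟨⟨s', h1⟩, h2⟩
  choose r hr using hex
  have hinj : Function.Injective r := by
    intro s s' h
    refine Subtype.ext (AscSeq.ext_col fun j => ?_)
    by_cases hj : j = c
    · rw [hj, s.2.1, s'.2.1]
    · rw [← hr s j hj, ← hr s' j hj, h]
  have hmass : ∀ s : colEvent c ℓ f g,
      ENNReal.ofReal (hahpMass M N t ζ s) *
          ENNReal.ofReal (weight t ℓ' f g (Finset.Icc 1 (M : ℤ))) =
        ENNReal.ofReal (hahpMass M N t ζ (r s)) *
          ENNReal.ofReal (weight t ℓ f g (Finset.Icc 1 (M : ℤ))) := by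
    intro s
    obtain ⟨R, e1, e2⟩ := hahpMass_eq_colWeight_mul N t ζ s.1 (r s).1 c (hr s)
      (by rw [s.2.1, (r s).2.1, hM])
    rw [AscSeq.colWeight, s.2.1, s.2.2.1, s.2.2.2] at e1
    rw [AscSeq.colWeight, (r s).2.1, (r s).2.2.1, (r s).2.2.2] at e2
    -- Only the weights need to be nonnegative here; the sign of the common factor `R` plays no
    -- role.
    rw [← ENNReal.ofReal_mul' (weight_nonneg ht _ _ _ h0' hf hg),
      ← ENNReal.ofReal_mul' (weight_nonneg ht _ _ _ h0 hf hg), e1, e2]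
    congr 1
    ring
  rw [hahp_apply, hahp_apply, ← ENNReal.tsum_mul_right, tsum_congr hmass, ENNReal.tsum_mul_right]
  gcongr
  exact ENNReal.tsum_comp_le_tsum_of_injective hinj
    fun s : colEvent c ℓ' f g => ENNReal.ofReal (hahpMass M N t ζ s)

/-- The weight of a column divides the mass: the factorization is applied to a sequence and itself.
-/
theorem hahp_colEvent_eq_zero (N : ℕ) (t ζ : ℝ) {M : ℕ} (c : ℕ) {ℓ : UpRightPath 0 (M : ℤ)}
    (f : Option (UpRightPath 0 (M : ℤ))) (g : UpRightPath 0 (M : ℤ))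
    (hW : weight t ℓ f g (Finset.Icc 1 (M : ℤ)) = 0) :
    hahp M N t ζ (colEvent c ℓ f g) = 0 := by
  rw [hahp_apply, ENNReal.tsum_eq_zero]
  intro s
  obtain ⟨R, e, -⟩ := hahpMass_eq_colWeight_mul N t ζ s.1 s.1 c (fun _ _ => rfl) rfl
  rw [AscSeq.colWeight, s.2.1, s.2.2.1, s.2.2.2, hW, zero_mul] at e
  rw [e, ENNReal.ofReal_zero]

theorem gibbsProperty_map_ensemble (M N : ℕ) {t : ℝ} (ht : t ∈ Set.Ioo (0 : ℝ) 1) (ζ : ℝ)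
    [IsFiniteMeasure (hahp M N t ζ)] :
    GibbsProperty t (Finset.Icc 1 (M : ℤ)) ((hahp M N t ζ).map (AscSeq.ensemble N)) := by
  classical
  intro i k hk a b f g hpos
  set μ := hahp M N t ζ with hμ
  set S := Finset.Icc 1 (M : ℤ) with hS
  set paths := (pathsBetween_finite 0 (M : ℤ) a b).toFinset with hpaths
  have hmap : ∀ B : Set (EnsembleSpace N 0 (M : ℤ)),
      μ.map (AscSeq.ensemble N) B = μ (AscSeq.ensemble N ⁻¹' B) := fun B =>
    Measure.map_apply (measurable_of_ascSeq _) trivial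
  set E := boundaryEvent i k a b f g with hE
  have hmemE : ∀ s : AscSeq M, s.ensemble N ∈ E ↔ s.col i ∈ pathsBetween 0 (M : ℤ) a b ∧
      s.aboveCol i = f ∧ s.col (i + 1) = g := by
    intro s
    rw [hE, boundaryEvent, Set.mem_ofPred_eq, s.ensemble_above, ← hk, pathsBetween,
      Set.mem_ofPred_eq, and_assoc]
    rfl
  have hslice : ∀ ℓ ∈ pathsBetween 0 (M : ℤ) a b,
      AscSeq.ensemble N ⁻¹' (E ∩ {L | L i = ℓ}) = colEvent i ℓ f g := by
    intro ℓ hℓ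
    ext s
    rw [Set.mem_preimage, Set.mem_inter_iff, hmemE]
    constructor
    · rintro ⟨⟨-, h1, h2⟩, h3⟩
      exact ⟨h3, h1, h2⟩
    · rintro ⟨h1, h2, h3⟩
      exact ⟨⟨h1 ▸ hℓ, h2, h3⟩, h1⟩
  have hsum : μ.map (AscSeq.ensemble N) E = ∑ ℓ ∈ paths, μ (colEvent i ℓ f g) := by
    rw [hmap, ← measure_biUnion_finset]
    · congr 1
      ext s
      simp only [Set.mem_preimage, hmemE, Set.mem_iUnion, hpaths, Set.Finite.mem_toFinset,
        colEvent, Set.mem_ofPred_eq, exists_prop]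
      exact ⟨fun h => ⟨_, h.1, rfl, h.2⟩, fun ⟨ℓ, h1, h2, h3⟩ => ⟨h2 ▸ h1, h3⟩⟩
    · intro ℓ _ ℓ' _ hne
      exact Set.disjoint_left.2 fun s h h' => hne (h.1.symm.trans h'.1)
    · exact fun _ _ => trivial
  -- A realization of the event shows that `a = 0` and that the boundary curves start at 0, as
  -- nonnegativity of the weights requires.
  obtain ⟨s₀, hs₀⟩ : ∃ s : AscSeq M, s.ensemble N ∈ E := by
    by_contra! h
    rw [hmap, show AscSeq.ensemble N ⁻¹' E = ∅ from Set.eq_empty_of_forall_notMem h,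
      measure_empty] at hpos
    exact lt_irrefl _ hpos
  rw [hmemE] at hs₀
  have ha : a = 0 := by rw [← hs₀.1.1, AscSeq.col_val_zero]
  have hg : g.val 0 = 0 := by rw [← hs₀.2.2, AscSeq.col_val_zero]
  have hf : ∀ f' ∈ f, f'.val 0 = 0 := by
    rw [← hs₀.2.1]
    generalize (i : ℕ) = c
    cases c with
    | zero => simp [AscSeq.aboveCol]
    | succ p => simp [AscSeq.aboveCol, AscSeq.col_val_zero]
  have hnn : ∀ ℓ ∈ paths, 0 ≤ weight t ℓ f g S := by
    intro ℓ hℓ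
    rw [hpaths, Set.Finite.mem_toFinset] at hℓ
    exact weight_nonneg ht ℓ f g (hℓ.1.trans ha) hf hg
  have hZ : 0 < partitionFn t a b f g S := by
    -- If every weight vanished, the conditioning event would be null.
    refine Finset.sum_pos' hnn ?_
    by_contra! h
    rw [hsum, Finset.sum_eq_zero fun ℓ hℓ =>
      hahp_colEvent_eq_zero N t ζ i f g (le_antisymm (h ℓ hℓ) (hnn ℓ hℓ))] at hpos
    exact lt_irrefl _ hpos
  refine ⟨hZ, fun ℓ hℓ => ?_⟩
  have hexch : ∀ ℓ' ∈ paths, μ (colEvent i ℓ f g) * ENNReal.ofReal (weight t ℓ' f g S) =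
      μ (colEvent i ℓ' f g) * ENNReal.ofReal (weight t ℓ f g S) := by
    intro ℓ' hℓ'
    rw [hpaths, Set.Finite.mem_toFinset] at hℓ'
    exact le_antisymm
      (hahp_colEvent_mul_le N ht ζ i f g (hℓ.1.trans ha) (hℓ'.1.trans ha) hf hg
        (hℓ'.2.trans hℓ.2.symm))
      (hahp_colEvent_mul_le N ht ζ i f g (hℓ'.1.trans ha) (hℓ.1.trans ha) hf hg
        (hℓ.2.trans hℓ'.2.symm))
  -- The exchange identity summed over `ℓ'`.
  have hprod : μ (colEvent i ℓ f g) * ENNReal.ofReal (partitionFn t a b f g S) =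
      μ.map (AscSeq.ensemble N) E * ENNReal.ofReal (weight t ℓ f g S) := by
    rw [partitionFn, ENNReal.ofReal_sum_of_nonneg hnn, Finset.mul_sum,
      Finset.sum_congr rfl hexch, hsum, Finset.sum_mul]
  have hreal := congrArg ENNReal.toReal hprod
  rw [ENNReal.toReal_mul, ENNReal.toReal_mul, ENNReal.toReal_ofReal hZ.le,
    ENNReal.toReal_ofReal (hnn ℓ ((Set.Finite.mem_toFinset _).2 hℓ))] at hreal
  have hE0 : 0 < (μ.map (AscSeq.ensemble N) E).toReal :=
    ENNReal.toReal_pos hpos.ne' (measure_ne_top _ _)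
  rw [measureReal_def, cond_apply (show MeasurableSet E from trivial), hmap (E ∩ _), hslice ℓ hℓ, ENNReal.toReal_mul,
    ENNReal.toReal_inv, eq_div_iff hZ.ne', mul_assoc, hreal, inv_mul_cancel_left₀ hE0.ne']

end HallLittlewood

theorem mainTheorem9 (M N : ℕ) (hM : 1 ≤ M) (hN : 1 ≤ N) (t ζ : ℝ)
    (ht : t ∈ Set.Ioo (0 : ℝ) 1) (hζ : ζ ∈ Set.Ioo (0 : ℝ) 1)
    {Ω : Type*} [MeasurableSpace Ω] (P : Measure Ω) [IsProbabilityMeasure P]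
    (Λ : Ω → HallLittlewood.AscSeq M) (hΛ : Measurable Λ)
    (hlaw : P.map Λ = HallLittlewood.hahp M N t ζ) :
    ∃ L : Ω → HallLittlewood.EnsembleSpace N 0 (M : ℤ),
      Measurable L ∧
      (∀ (ω : Ω) (j : Fin N) (i : Fin (M + 1)),
        (L ω j).val ((i : ℕ) : ℤ) = HallLittlewood.conjPart ((Λ ω).lam i) ((j : ℕ) + 1)) ∧
      HallLittlewood.GibbsProperty t (Finset.Icc 1 (M : ℤ)) (P.map L) := by
  have hF : Measurable (HallLittlewood.AscSeq.ensemble (M := M) N) :=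
    HallLittlewood.measurable_of_ascSeq _
  refine ⟨fun ω => (Λ ω).ensemble N, hF.comp hΛ, fun ω j i => ?_, ?_⟩
  · rw [HallLittlewood.conjPart_succ]
    exact (Λ ω).col_val j i
  -- Finiteness comes from `hlaw`, so the normalizing constant never has to be computed.
  · have hfin : IsFiniteMeasure (HallLittlewood.hahp M N t ζ) := by
      rw [← hlaw]
      infer_instance
    have := HallLittlewood.gibbsProperty_map_ensemble M N ht ζ
    rwa [← hlaw, Measure.map_map hF hΛ] at this
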